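/- Let $\mathbf{Met}$ be the category of extended metric spaces (distance $\infty$ is allowed) and nonexpanding maps, with tensor product the cartesian product with the addition metric $d((x,y),(x',y'))=d(x,x')+d(y,y')$. A metric-enriched category is a category with an extended metric on each hom-set such that $d(g\cdot f,g'\cdot f')\le d(f,f')+d(g,g')$; a functor between such categories is enriched if it is locally nonexpanding ($d(Ff,Fg)\le d(f,g)$), and an equivalence of metric-enriched categories consists of enriched functors. Let $\mathbf{Mon}(\mathbf{Met})$ be the category of monoids in $(\mathbf{Met},\otimes,1)$, that is, of extended metric spaces with a monoid structure satisfying $d(xy,x'y')\le d(x,x')+d(y,y')$, and of nonexpanding monoid homomorphisms, with the supremum metric on hom-sets. For a set $A$ let $A^*$ be the free monoid on $A$ with the discrete metric (distinct elements have distance $\infty$). For a finitary signature $\Sigma$, a quantitative $\Sigma$-algebra is an extended metric space with operations $A^n\to A$ that are nonexpanding with respect to the maximum metric; morphisms are the nonexpanding homomorphisms, with the supremum metric. A variety is a full subcategory of quantitative $\Sigma$-algebras specified by a set of quantitative equations $t=_\varepsilon t'$ ($t,t'$ terms over a finite set of variables, $\varepsilon\ge 0$ real), where $A$ satisfies $t=_\varepsilon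 t'$ if the values of $t$ and $t'$ have distance at most $\varepsilon$ under every interpretation of the variables in $A$. In a metric-enriched category $\mathcal K$, a basic diagram on $X$ is a functor $\varepsilon\mapsto D\varepsilon$ from the ordered set of real numbers $\varepsilon\ge 0$ to $\mathcal K$ with two cocones $l_\varepsilon,r_\varepsilon\colon D\varepsilon\to X$. A morphism $f\colon X\to C$ is its colimit map if (i) $d(f\cdot l_\varepsilon,f\cdot r_\varepsilon)\le\varepsilon$ for all $\varepsilon$, (ii) $d(u_1,u_2)=d(u_1\cdot f,u_2\cdot f)$ for all parallel pairs $u_1,u_2$ with domain $C$, and (iii) every $f'\colon X\to C'$ satisfying (i) factorizes through $f$. A subregular epimorphism is a colimit map of some basic diagram. An object $G$ is a subregular projective if every morphism $G\to Y$ factorizes through each subregular epimorphism $X\to Y$. It is abstractly finite if it has copowers and every morphism from $G$ to a copower $\coprod_M G$ factorizes through a finite subcopower. It is a subregular generator if its hom-functor $\mathcal K(G,-)\colon\mathcal K\to\mathbf{Met}$ has an enriched left adjoint $-\otimes G$ and all evaluation morphisms (counit components) $\mathcal K(G,X)\otimes G\to X$ are subregular epimorphisms. A subvarietal generator is an abstractly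 finite, subregularly projective subregular generator. Then the following hold. 1. $\mathbf{Mon}(\mathbf{Met})$ is not equivalent, as a metric-enriched category, to any variety of quantitative algebras. 2. $\mathbf{Mon}(\mathbf{Met})$ has no subvarietal generator. 3. Every subregular projective of $\mathbf{Mon}(\mathbf{Met})$ is isomorphic to $A^*$ for some set $A$. 4. For every nonempty set $A$, the hom-functor $\mathbf{Mon}(\mathbf{Met})(A^*,-)\colon\mathbf{Mon}(\mathbf{Met})\to\mathbf{Met}$ has a left adjoint (as an ordinary functor), but no left adjoint of it is enriched. -/

import Mathlib

open CategoryTheory CategoryTheory.Limits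
open scoped ENNReal NNReal

universe w v u

namespace QuantAlg

noncomputable section

/-! ## Metric-enriched categories -/

/-- A metric-enriched category: every hom-set carries an extended metric, and composition is
nonexpanding with respect to the addition metric. -/
class MetricEnriched (C : Type w) [Category.{v} C] where
  homMetric : ∀ X Y : C, EMetricSpace (X ⟶ Y)
  edist_comp_le : ∀ {X Y Z : C} (f f' : X ⟶ Y) (g g' : Y ⟶ Z),
    edist (f ≫ g) (f' ≫ g') ≤ edist f f' + edist g g'

attribute [instance, reducible] MetricEnriched.homMetric

/-- A functor between metric-enriched categories is enriched if it is locally nonexpanding. -/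
def IsEnrichedFunctor {C : Type*} [Category C] [MetricEnriched C] {D : Type*} [Category D]
    [MetricEnriched D] (F : C ⥤ D) : Prop :=
  ∀ ⦃X Y : C⦄ (f g : X ⟶ Y), edist (F.map f) (F.map g) ≤ edist f g

/-- Equivalence of metric-enriched categories. -/
def EnrichedEquivalent (C : Type*) [Category C] [MetricEnriched C] (D : Type*) [Category D]
    [MetricEnriched D] : Prop :=
  ∃ e : C ≌ D, IsEnrichedFunctor e.functor ∧ IsEnrichedFunctor e.inverse

/-- The supremum metric on a type `H` of functions from `X` to `Y`. -/
abbrev supMetric {H X Y : Type*} [EMetricSpace Y] (coe : H → X → Y)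
    (inj : Function.Injective coe) : EMetricSpace H where
  edist f g := ⨆ x, edist (coe f x) (coe g x)
  edist_self f := by simp
  edist_comm f g := by simp only [edist_comm]
  edist_triangle f g h := iSup_le fun x =>
    (edist_triangle _ (coe g x) _).trans (add_le_add
      (le_iSup (fun x => edist (coe f x) (coe g x)) x)
      (le_iSup (fun x => edist (coe g x) (coe h x)) x))
  eq_of_edist_eq_zero {f g} h := inj <| funext fun x =>
    edist_le_zero.mp <| h ▸ le_iSup (fun x => edist (coe f x) (coe g x)) x

/-- The discrete metric: distinct points have distance `∞`. -/
abbrev discreteMetric (X : Type*) : EMetricSpace X where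
  edist x y := ⨆ _ : x ≠ y, ⊤
  edist_self x := by simp
  edist_comm x y := by simp only [ne_comm]
  edist_triangle x y z := by
    by_cases h : x = y
    · subst h; simp
    · simp [h]
  eq_of_edist_eq_zero {x y} h := by
    by_contra hne
    simp [hne] at h

/-! ## The category of extended metric spaces and nonexpanding maps -/

/-- Extended metric spaces. -/
structure Met : Type (u + 1) where
  carrier : Type u
  [metric : EMetricSpace carrier]

namespace Met

instance : CoeSort Met.{u} (Type u) := ⟨Met.carrier⟩

instance (X : Met.{u}) : EMetricSpace X := X.metric

/-- Nonexpanding maps. -/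
@[ext]
structure Hom (X Y : Met.{u}) : Type u where
  toFun : X → Y
  nonexpanding : ∀ x x' : X, edist (toFun x) (toFun x') ≤ edist x x'

instance : Category Met.{u} where
  Hom := Hom
  id X := ⟨fun x => x, fun _ _ => le_rfl⟩
  comp f g := ⟨fun x => g.toFun (f.toFun x),
    fun _ _ => (g.nonexpanding _ _).trans (f.nonexpanding _ _)⟩

instance : MetricEnriched Met.{u} where
  homMetric X Y := supMetric (fun f : Hom X Y => f.toFun) fun _ _ h => Hom.ext h
  edist_comp_le f f' g g' := iSup_le fun x =>
    (edist_triangle _ (g.toFun (f'.toFun x)) _).trans <| add_le_add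
      ((g.nonexpanding _ _).trans
        (le_iSup (fun x => edist (f.toFun x) (f'.toFun x)) x))
      (le_iSup (fun y => edist (g.toFun y) (g'.toFun y)) (f'.toFun x))

end Met

/-! ## Notions in a metric-enriched category -/

section Enriched

variable {C : Type w} [Category.{v} C] [MetricEnriched C]

/-- The hom-functor of an object, with values in extended metric spaces. -/
def homFunctor (K : C) : C ⥤ Met.{v} where
  obj X := ⟨K ⟶ X⟩
  map f := ⟨fun g => g ≫ f, fun g g' =>
    (MetricEnriched.edist_comp_le g g' f f).trans (by simp)⟩
  map_id X := Met.Hom.ext (funext fun g => Category.comp_id g)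
  map_comp f f' := Met.Hom.ext (funext fun g => (Category.assoc g f f').symm)

/-- `p` is a quotient: precomposition with `p` preserves distances. -/
def IsQuotient {P X : C} (p : P ⟶ X) : Prop :=
  ∀ ⦃U : C⦄ (u₁ u₂ : X ⟶ U), edist u₁ u₂ = edist (p ≫ u₁) (p ≫ u₂)

/-- A basic diagram with `D a = X`: a diagram indexed by the chain of all real numbers `ε ≥ 0`
together with two cocones `l`, `r` with codomain `X`. -/
structure BasicDiagram (X : C) where
  D : ℝ≥0 ⥤ C
  l : D ⟶ (Functor.const ℝ≥0).obj X
  r : D ⟶ (Functor.const ℝ≥0).obj X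

/-- The compatibility condition `d(f · D l_ε, f · D r_ε) ≤ ε` for all `ε`. -/
def BasicDiagram.Compatible {X : C} (D : BasicDiagram X) {Y : C} (f : X ⟶ Y) : Prop :=
  ∀ ε : ℝ≥0, edist (D.l.app ε ≫ f) (D.r.app ε ≫ f) ≤ (ε : ℝ≥0∞)

/-- `f` is the colimit map of the basic diagram: the universal compatible morphism. -/
structure BasicDiagram.IsColimitMap {X : C} (D : BasicDiagram X) {Y : C} (f : X ⟶ Y) :
    Prop where
  compatible : D.Compatible f
  quotient : IsQuotient f
  factors : ∀ ⦃Z : C⦄ (f' : X ⟶ Z), D.Compatible f' → ∃ h : Y ⟶ Z, f ≫ h = f'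

/-- Subregular epimorphisms: colimit maps of basic diagrams. -/
def IsSubregularEpi {X Y : C} (f : X ⟶ Y) : Prop :=
  ∃ D : BasicDiagram X, D.IsColimitMap f

/-- Subregular projectives. -/
def IsSubregularProjective (K : C) : Prop :=
  ∀ ⦃X Y : C⦄ (e : X ⟶ Y), IsSubregularEpi e → ∀ g : K ⟶ Y, ∃ h : K ⟶ X, h ≫ e = g

/-- Abstractly finite objects: objects with copowers such that every morphism into a copower of
the object factorizes through a finite subcopower. -/
structure IsAbstractlyFinite {C : Type w} [Category.{v} C] (X : C) : Prop where
  copowers : ∀ M : Type v, HasCoproduct fun _ : M => X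
  factors : ∀ (M : Type v) (f : X ⟶ ∐ fun _ : M => X), ∃ (s : Finset M)
    (g : X ⟶ ∐ fun _ : s => X),
    g ≫ Sigma.desc (fun i : s => Sigma.ι (fun _ : M => X) i.1) = f

/-- `L` together with `adj` exhibits the tensors `M ⊗ K = L.obj M`: it is an enriched left adjoint
of the hom-functor of `K`. The evaluation morphism `C(K, X) ⊗ K ⟶ X` is the counit at `X`. An
object is a subregular generator if it has tensors and all evaluation morphisms are
subregular epimorphisms. -/
def IsSubregularGenerator (K : C) : Prop :=
  ∃ (L : Met.{v} ⥤ C) (adj : L ⊣ homFunctor K), IsEnrichedFunctor L ∧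
    ∀ X : C, IsSubregularEpi (adj.counit.app X)

/-- Subvarietal generators: abstractly finite, subregularly projective subregular generators. -/
structure IsSubvarietalGenerator (G : C) : Prop where
  generator : IsSubregularGenerator G
  abstractlyFinite : IsAbstractlyFinite G
  projective : IsSubregularProjective G

end Enriched

/-! ## Quantitative algebras and their varieties -/

/-- A finitary signature: a set of `n`-ary operation symbols for every `n`. -/
def Signature : Type (u + 1) := ℕ → Type u

/-- A quantitative algebra: operations are nonexpanding with respect to the maximum metric
(the metric of the function space `Fin n → carrier`). -/
structure Algebra (S : Signature.{u}) : Type (u + 1) where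
  carrier : Type u
  [metric : EMetricSpace carrier]
  op : ∀ {n : ℕ}, S n → (Fin n → carrier) → carrier
  op_nonexpanding : ∀ {n : ℕ} (σ : S n) (x y : Fin n → carrier),
    edist (op σ x) (op σ y) ≤ edist x y

namespace Algebra

variable {S : Signature.{u}}

instance : CoeSort (Algebra.{u} S) (Type u) := ⟨Algebra.carrier⟩

instance (A : Algebra.{u} S) : EMetricSpace A := A.metric

/-- Nonexpanding homomorphisms. -/
@[ext]
structure Hom (A B : Algebra.{u} S) : Type u where
  toFun : A → B
  map_op : ∀ {n : ℕ} (σ : S n) (x : Fin n → A), toFun (A.op σ x) = B.op σ fun i => toFun (x i)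
  nonexpanding : ∀ x x' : A, edist (toFun x) (toFun x') ≤ edist x x'

instance : Category (Algebra.{u} S) where
  Hom := Hom
  id A := ⟨fun x => x, fun _ _ => rfl, fun _ _ => le_rfl⟩
  comp f g := ⟨fun x => g.toFun (f.toFun x), fun σ x => by rw [f.map_op, g.map_op],
    fun _ _ => (g.nonexpanding _ _).trans (f.nonexpanding _ _)⟩

instance : MetricEnriched (Algebra.{u} S) where
  homMetric X Y := supMetric (fun f : Hom X Y => f.toFun) fun _ _ h => Hom.ext h
  edist_comp_le f f' g g' := iSup_le fun x =>
    (edist_triangle _ (g.toFun (f'.toFun x)) _).trans <| add_le_add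
      ((g.nonexpanding _ _).trans
        (le_iSup (fun x => edist (f.toFun x) (f'.toFun x)) x))
      (le_iSup (fun y => edist (g.toFun y) (g'.toFun y)) (f'.toFun x))

end Algebra

/-- Terms over a signature with variables in `X`. -/
inductive Term (S : Signature.{u}) (X : Type v) : Type (max u v)
  | var (x : X) : Term S X
  | app {n : ℕ} (σ : S n) (t : Fin n → Term S X) : Term S X

/-- The value of a term under an interpretation of its variables. -/
def Term.eval {S : Signature.{u}} {X : Type v} (A : Algebra.{u} S) (f : X → A) : Term S X → A
  | .var x => f x
  | .app σ t => A.op σ fun i => (t i).eval A f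

/-- A quantitative equation `lhs =_ε rhs` over a finite set of variables. -/
structure QuantEquation (S : Signature.{u}) : Type u where
  numVars : ℕ
  lhs : Term S (Fin numVars)
  rhs : Term S (Fin numVars)
  ε : ℝ≥0

/-- Satisfaction of a quantitative equation. -/
def Algebra.Satisfies {S : Signature.{u}} (A : Algebra.{u} S) (e : QuantEquation S) : Prop :=
  ∀ f : Fin e.numVars → A, edist (e.lhs.eval A f) (e.rhs.eval A f) ≤ (e.ε : ℝ≥0∞)

/-- The variety of quantitative algebras specified by a set of quantitative equations. -/
abbrev Variety (S : Signature.{u}) (E : Set (QuantEquation S)) : Type (u + 1) :=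
  ObjectProperty.FullSubcategory fun A : Algebra.{u} S => ∀ e ∈ E, A.Satisfies e

/-- A full subcategory inherits the metrics of the hom-sets. -/
instance {C : Type w} [Category.{v} C] [MetricEnriched C] (P : ObjectProperty C) :
    MetricEnriched P.FullSubcategory where
  homMetric X Y := EMetricSpace.induced (fun f : X ⟶ Y => f.hom)
    (fun _ _ h => ObjectProperty.hom_ext _ h) inferInstance
  edist_comp_le f f' g g' := MetricEnriched.edist_comp_le f.hom f'.hom g.hom g'.hom

/-! ## Monoids in the category of metric spaces -/

/-- Monoids in the monoidal category of extended metric spaces with the addition metric as tensor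
product: the multiplication is nonexpanding with respect to the addition metric. -/
structure MonMet : Type (u + 1) where
  carrier : Type u
  [metric : EMetricSpace carrier]
  [monoid : Monoid carrier]
  edist_mul_le : ∀ x x' y y' : carrier, edist (x * y) (x' * y') ≤ edist x x' + edist y y'

namespace MonMet

instance : CoeSort MonMet.{u} (Type u) := ⟨MonMet.carrier⟩

instance (M : MonMet.{u}) : EMetricSpace M := M.metric

instance (M : MonMet.{u}) : Monoid M := M.monoid

/-- Nonexpanding monoid homomorphisms. -/
structure Hom (M N : MonMet.{u}) : Type u where
  toHom : M →* N
  nonexpanding : ∀ x x' : M, edist (toHom x) (toHom x') ≤ edist x x'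

theorem Hom.ext_fun {M N : MonMet.{u}} {f g : Hom M N}
    (h : (fun x => f.toHom x) = fun x => g.toHom x) : f = g := by
  obtain ⟨f, hf⟩ := f
  obtain ⟨g, hg⟩ := g
  have : f = g := MonoidHom.ext (congrFun h)
  subst this
  rfl

instance : Category MonMet.{u} where
  Hom := Hom
  id M := ⟨MonoidHom.id M, fun _ _ => le_rfl⟩
  comp f g := ⟨g.toHom.comp f.toHom,
    fun _ _ => (g.nonexpanding _ _).trans (f.nonexpanding _ _)⟩

instance : MetricEnriched MonMet.{u} where
  homMetric X Y := supMetric (fun (f : Hom X Y) x => f.toHom x) fun _ _ h => Hom.ext_fun h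
  edist_comp_le f f' g g' := iSup_le fun x =>
    (edist_triangle _ (g.toHom (f'.toHom x)) _).trans <| add_le_add
      ((g.nonexpanding _ _).trans
        (le_iSup (fun x => edist (f.toHom x) (f'.toHom x)) x))
      (le_iSup (fun y => edist (g.toHom y) (g'.toHom y)) (f'.toHom x))

/-- The discrete monoid of words over the alphabet `A`. -/
def words (A : Type u) : MonMet.{u} where
  carrier := FreeMonoid A
  metric := discreteMetric _
  edist_mul_le x x' y y' := by
    by_cases hx : x = x'
    · by_cases hy : y = y'
      · subst hx hy; simp
      · simp [hy, edist]
    · simp [hx, edist]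

end MonMet

end

end QuantAlg

namespace QuantAlg

noncomputable section

namespace MonMet

/-! ## Constructions of metric monoids -/

theorem edist_hom_le_iff {M N : MonMet.{u}} {f g : M ⟶ N} {r : ℝ≥0∞} :
    edist f g ≤ r ↔ ∀ x : M, edist (f.toHom x) (g.toHom x) ≤ r :=
  iSup_le_iff

theorem edist_apply_le {M N : MonMet.{u}} (f g : M ⟶ N) (x : M) :
    edist (f.toHom x) (g.toHom x) ≤ edist f g :=
  le_iSup (fun x => edist (f.toHom x) (g.toHom x)) x

/-- The constant homomorphism. -/
def trivialHom (M N : MonMet.{u}) : M ⟶ N :=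
  Hom.mk 1 fun _ _ => by simp

/-- The metric of a monoid truncated at `1`. -/
def truncate (M : MonMet.{u}) : MonMet.{u} where
  carrier := M
  metric :=
    { edist := fun x y => min (edist x y) 1
      edist_self := fun x => by simp
      edist_comm := fun x y => by simp only [edist_comm]
      edist_triangle := fun x y z => by
        rcases le_total (edist x y) 1 with h | h
        · rcases le_total (edist y z) 1 with h' | h'
          · rw [min_eq_left h, min_eq_left h']
            exact (min_le_left _ _).trans (edist_triangle _ _ _)
          · rw [min_eq_right h']
            exact (min_le_right _ _).trans le_add_self
        · rw [min_eq_right h]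
          exact (min_le_right _ _).trans le_self_add
      eq_of_edist_eq_zero := fun {x y} h => by
        rcases min_eq_iff.mp h with h | h
        · exact eq_of_edist_eq_zero h.1
        · exact absurd h.1 one_ne_zero }
  monoid := inferInstance
  edist_mul_le x x' y y' := by
    change min (edist (x * y) (x' * y')) 1 ≤ min (edist x x') 1 + min (edist y y') 1
    rcases le_total (edist x x') 1 with h | h
    · rcases le_total (edist y y') 1 with h' | h'
      · rw [min_eq_left h, min_eq_left h']
        exact (min_le_left _ _).trans (M.edist_mul_le _ _ _ _)
      · rw [min_eq_right h']
        exact (min_le_right _ _).trans le_add_self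
    · rw [min_eq_right h]
      exact (min_le_right _ _).trans le_self_add

theorem truncate_edist_le_one {M : MonMet.{u}} (x y : truncate M) : edist x y ≤ 1 :=
  min_le_right _ _

/-- The identity map to the truncation. -/
def toTruncate (M : MonMet.{u}) : M ⟶ truncate M :=
  Hom.mk (MonoidHom.id M) fun _ _ => min_le_left _ _

/-- The product of two metric monoids with the addition metric. -/
def prodSum (M N : MonMet.{u}) : MonMet.{u} where
  carrier := M × N
  metric :=
    { edist := fun x y => edist x.1 y.1 + edist x.2 y.2
      edist_self := fun x => by simp
      edist_comm := fun x y => by simp only [edist_comm]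
      edist_triangle := fun x y z =>
        (add_le_add (edist_triangle x.1 y.1 z.1) (edist_triangle x.2 y.2 z.2)).trans_eq
          (add_add_add_comm _ _ _ _)
      eq_of_edist_eq_zero := fun {x y} h => by
        obtain ⟨h₁, h₂⟩ := add_eq_zero.mp h
        exact Prod.ext (eq_of_edist_eq_zero h₁) (eq_of_edist_eq_zero h₂) }
  monoid := inferInstanceAs (Monoid (M × N))
  edist_mul_le x x' y y' :=
    (add_le_add (M.edist_mul_le x.1 x'.1 y.1 y'.1) (N.edist_mul_le x.2 x'.2 y.2 y'.2)).trans_eq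
      (add_add_add_comm _ _ _ _)

/-- The first embedding in a product. -/
def prodInl (M N : MonMet.{u}) : M ⟶ prodSum M N :=
  Hom.mk (MonoidHom.inl M N) fun x x' => by
    change edist x x' + edist (1 : N) 1 ≤ _
    simp

/-- The second embedding in a product. -/
def prodInr (M N : MonMet.{u}) : N ⟶ prodSum M N :=
  Hom.mk (MonoidHom.inr M N) fun x x' => by
    change edist (1 : M) 1 + edist x x' ≤ _
    simp

/-! ## Enriched left adjoints of hom-functors -/

/-- Two points at distance `∞`. -/
def twoPoints : Met.{u} :=
  @Met.mk (ULift.{u} Bool) (discreteMetric _)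

/-- A pair of points as a map from `twoPoints`. -/
def pairMap {X : Met.{u}} (x y : X) : twoPoints ⟶ X :=
  Met.Hom.mk (fun b => bif b.down then x else y) fun a b => by
    by_cases h : a = b
    · subst h; simp
    · exact le_of_le_of_eq le_top (by
        change ⊤ = ⨆ _ : a ≠ b, ⊤
        simp [h])

theorem edist_pairMap_le {X : Met.{u}} {x y x' y' : X} {r : ℝ≥0∞} (hx : edist x x' ≤ r)
    (hy : edist y y' ≤ r) : edist (pairMap x y) (pairMap x' y') ≤ r := by
  refine iSup_le ?_
  rintro ⟨_ | _⟩
  · exact hy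
  · exact hx

/-- Two maps from a two-point space into the hom-space of `P × P` are at distance at most `d(φ, ψ)`,
so an enriched `L` gives the same bound for their transposes. Those are compared on a product of one
element from each copy of `G`, where the addition metric sums the two errors. -/
theorem not_isEnrichedFunctor_of_nontrivial {G : MonMet.{u}} [Nontrivial G]
    {L : Met.{u} ⥤ MonMet.{u}} (adj : L ⊣ homFunctor G) : ¬ IsEnrichedFunctor L := by
  intro hL
  -- Truncation keeps `d(φ, ψ)` finite, which is what makes `2d ≤ d` force `d = 0`.
  let P := truncate G
  let φ : G ⟶ P := toTruncate G
  let ψ : G ⟶ P := trivialHom G P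
  let N := prodSum P P
  let i₁ : P ⟶ N := prodInl P P
  let i₂ : P ⟶ N := prodInr P P
  let f : twoPoints ⟶ (homFunctor G).obj N := pairMap (X := ⟨G ⟶ N⟩) (φ ≫ i₁) (φ ≫ i₂)
  let g : twoPoints ⟶ (homFunctor G).obj N := pairMap (X := ⟨G ⟶ N⟩) (ψ ≫ i₁) (ψ ≫ i₂)
  have hφψ : edist φ ψ ≤ 1 := edist_hom_le_iff.mpr fun x => truncate_edist_le_one _ _
  have comp_le (i : P ⟶ N) : edist (φ ≫ i) (ψ ≫ i) ≤ edist φ ψ :=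
    (MetricEnriched.edist_comp_le _ _ _ _).trans (by simp)
  have hfg : edist f g ≤ edist φ ψ :=
    edist_pairMap_le (X := ⟨G ⟶ N⟩) (comp_le i₁) (comp_le i₂)
  let η := adj.unit.app twoPoints
  let f' : L.obj twoPoints ⟶ N := L.map f ≫ adj.counit.app N
  let g' : L.obj twoPoints ⟶ N := L.map g ≫ adj.counit.app N
  have hfg' : edist f' g' ≤ edist φ ψ :=
    (MetricEnriched.edist_comp_le _ _ _ _).trans
      ((by simp : _ ≤ edist (L.map f) (L.map g)).trans ((hL f g).trans hfg))
  have hη (f : twoPoints ⟶ (homFunctor G).obj N) (b : twoPoints.{u}) :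
      η.toFun b ≫ L.map f ≫ adj.counit.app N = f.toFun b := by
    have : adj.unit.app _ ≫ (homFunctor G).map (L.map f ≫ adj.counit.app N) = f := by
      simp
    exact congrArg (fun k : twoPoints ⟶ (homFunctor G).obj N => k.toFun b) this
  have key (x : G) : 2 * edist (φ.toHom x) (ψ.toHom x) ≤ edist φ ψ := by
    let η₁ : G ⟶ L.obj twoPoints := η.toFun ⟨true⟩
    let η₂ : G ⟶ L.obj twoPoints := η.toFun ⟨false⟩
    -- The transposes send this product to `(φ x, φ x)` and `(ψ x, ψ x)`, which lie at distance `2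
    -- d(φ x, ψ x)`.
    have h := (edist_apply_le f' g' (η₁.toHom x * η₂.toHom x)).trans hfg'
    rw [map_mul, map_mul] at h
    have h₁ : f'.toHom (η₁.toHom x) = i₁.toHom (φ.toHom x) :=
      congrArg (fun k : G ⟶ N => k.toHom x) (hη f ⟨true⟩)
    have h₂ : f'.toHom (η₂.toHom x) = i₂.toHom (φ.toHom x) :=
      congrArg (fun k : G ⟶ N => k.toHom x) (hη f ⟨false⟩)
    have h₃ : g'.toHom (η₁.toHom x) = i₁.toHom (ψ.toHom x) :=
      congrArg (fun k : G ⟶ N => k.toHom x) (hη g ⟨true⟩)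
    have h₄ : g'.toHom (η₂.toHom x) = i₂.toHom (ψ.toHom x) :=
      congrArg (fun k : G ⟶ N => k.toHom x) (hη g ⟨false⟩)
    rw [h₁, h₂, h₃, h₄] at h
    refine le_trans (le_of_eq ?_) h
    change _ = edist (φ.toHom x * 1) (ψ.toHom x * 1) + edist (1 * φ.toHom x) (1 * ψ.toHom x)
    rw [mul_one, mul_one, one_mul, one_mul, two_mul]
  have hle : 2 * edist φ ψ ≤ edist φ ψ := by
    change 2 * (⨆ x : G, edist (φ.toHom x) (ψ.toHom x)) ≤ _
    rw [ENNReal.mul_iSup]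
    exact iSup_le key
  have h0 : edist φ ψ = 0 := by
    by_contra hne
    have hfin : edist φ ψ ≠ ⊤ := ne_top_of_le_ne_top ENNReal.one_ne_top hφψ
    rw [two_mul] at hle
    exact absurd hle (not_le.mpr (ENNReal.lt_add_right hfin hne))
  obtain ⟨x, hx⟩ := exists_ne (1 : G)
  exact hx (congrArg (fun k : G ⟶ P => k.toHom x) (eq_of_edist_eq_zero h0))

theorem hom_to_words_nonexpanding {A : Type u} {N : MonMet.{u}} (f : FreeMonoid A →* N)
    (x x' : words A) : edist (f x) (f x') ≤ edist x x' := by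
  by_cases h : x = x'
  · subst h; simp
  · refine le_top.trans_eq ?_
    change ⊤ = ⨆ _ : x ≠ x', ⊤
    simp [h]

instance nontrivial_words (A : Type u) [Nonempty A] : Nontrivial (words A) :=
  inferInstanceAs (Nontrivial (FreeMonoid A))

theorem not_isSubregularGenerator (G : MonMet.{u}) : ¬ IsSubregularGenerator G := by
  rintro ⟨L, adj, hL, hε⟩
  rcases subsingleton_or_nontrivial G with hG | hG
  -- For trivial `G` every hom-space out of `G` is a single point, so by adjunction each tensor has
  -- only one morphism to any object. The quotient property of the counit would then identify all
  -- parallel morphisms.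
  · have hsub (X Y : MonMet.{u}) (f g : (L.obj ((homFunctor G).obj X)) ⟶ Y) : f = g := by
      apply (adj.homEquiv _ _).injective
      refine Met.Hom.ext (funext fun x => Hom.ext_fun (funext fun y => ?_))
      rw [Subsingleton.elim y 1, map_one, map_one]
    obtain ⟨D, hD⟩ := hε (words PUnit)
    have h := hD.quotient (𝟙 _) (trivialHom _ _)
    rw [hsub _ _ (_ ≫ 𝟙 _) (_ ≫ trivialHom _ _), edist_self] at h
    obtain ⟨x, hx⟩ := exists_ne (1 : words PUnit.{u + 1})
    exact hx (congrArg (fun k : words PUnit ⟶ words PUnit => k.toHom x) (eq_of_edist_eq_zero h))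
  · exact not_isEnrichedFunctor_of_nontrivial adj hL

end MonMet

/-! ## Universal morphisms on which two given morphisms are close -/

/-- Every parallel pair `f`, `g` and every `ε` admit a weakly universal morphism `m` with
`d(f · m, g · m) ≤ ε`. -/
def HasApproxEqualizers (C : Type w) [Category.{v} C] [MetricEnriched C] : Prop :=
  ∀ ⦃X Y : C⦄ (f g : X ⟶ Y) (ε : ℝ≥0∞), ∃ (B : C) (m : B ⟶ X), edist (m ≫ f) (m ≫ g) ≤ ε ∧
    ∀ ⦃K : C⦄ (h : K ⟶ X), edist (h ≫ f) (h ≫ g) ≤ ε → ∃ k : K ⟶ B, k ≫ m = h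

theorem HasApproxEqualizers.of_equivalent {C : Type*} [Category C] [MetricEnriched C]
    {D : Type*} [Category D] [MetricEnriched D] (h : EnrichedEquivalent C D)
    (hD : HasApproxEqualizers D) : HasApproxEqualizers C := by
  obtain ⟨e, hF, hG⟩ := h
  intro X Y f g ε
  obtain ⟨B, m, hm, hu⟩ := hD (e.functor.map f) (e.functor.map g) ε
  have nat (f : X ⟶ Y) : (e.inverse.map m ≫ e.unitIso.inv.app X) ≫ f =
      e.inverse.map (m ≫ e.functor.map f) ≫ e.unitIso.inv.app Y := by
    have := e.unitIso.inv.naturality f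
    simp only [Functor.comp_map, Functor.id_map] at this
    rw [Category.assoc, ← this, Functor.map_comp, Category.assoc]
  refine ⟨e.inverse.obj B, e.inverse.map m ≫ e.unitIso.inv.app X, ?_, fun K k hk => ?_⟩
  · rw [nat f, nat g]
    exact (MetricEnriched.edist_comp_le _ _ _ _).trans
      (le_trans (by simp) ((hG (m ≫ e.functor.map f) (m ≫ e.functor.map g)).trans hm))
  · obtain ⟨l, hl⟩ := hu (e.functor.map k) (by
      rw [← Functor.map_comp, ← Functor.map_comp]
      exact (hF _ _).trans hk)
    refine ⟨e.unitIso.hom.app K ≫ e.inverse.map l, ?_⟩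
    have := e.unitIso.hom.naturality k
    simp only [Functor.comp_map, Functor.id_map] at this
    rw [Category.assoc, ← Category.assoc (e.inverse.map l), ← Functor.map_comp, hl,
      ← Category.assoc, ← this, Category.assoc]
    simp

theorem Term.eval_hom {S : Signature.{u}} {X : Type v} {A B : Algebra.{u} S} (h : A ⟶ B)
    (f : X → A) (t : Term S X) : h.toFun (t.eval A f) = t.eval B fun x => h.toFun (f x) := by
  induction t with
  | var x => rfl
  | app σ t ih =>
    simp only [Term.eval]
    rw [h.map_op]
    exact congrArg _ (funext ih)

/-- The subalgebra of the points at which two homomorphisms are `ε`-close. -/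
def Algebra.approxEqualizer {S : Signature.{u}} {A B : Algebra.{u} S} (f g : A ⟶ B)
    (ε : ℝ≥0∞) : Algebra.{u} S where
  carrier := {x : A // edist (f.toFun x) (g.toFun x) ≤ ε}
  op σ x := ⟨A.op σ fun i => (x i).1, by
    rw [f.map_op, g.map_op]
    exact (B.op_nonexpanding _ _ _).trans (edist_pi_le_iff.mpr fun i => (x i).2)⟩
  op_nonexpanding σ x y := A.op_nonexpanding σ (fun i => (x i).1) fun i => (y i).1

/-- The inclusion of the points at which two homomorphisms are `ε`-close. -/
def Algebra.approxEqualizerIncl {S : Signature.{u}} {A B : Algebra.{u} S} (f g : A ⟶ B)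
    (ε : ℝ≥0∞) : Algebra.approxEqualizer f g ε ⟶ A :=
  Algebra.Hom.mk Subtype.val (fun _ _ => rfl) fun _ _ => le_rfl

/-- Quantitative equations pass to the subalgebra because its inclusion preserves distances and
commutes with the evaluation of terms. -/
theorem Variety.hasApproxEqualizers (S : Signature.{u}) (E : Set (QuantEquation S)) :
    HasApproxEqualizers (Variety S E) := by
  intro X Y f g ε
  let m := Algebra.approxEqualizerIncl f.hom g.hom ε
  refine ⟨⟨Algebra.approxEqualizer f.hom g.hom ε, fun e he v => ?_⟩, ObjectProperty.homMk m, ?_,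
    fun K h hh => ?_⟩
  · have := X.property e he fun i => m.toFun (v i)
    rw [← Term.eval_hom m, ← Term.eval_hom m] at this
    exact this
  · exact iSup_le fun x => x.2
  · refine ⟨ObjectProperty.homMk (Algebra.Hom.mk (fun x => ⟨h.hom.toFun x, ?_⟩) ?_ ?_), ?_⟩
    · exact (le_iSup (fun x => edist (f.hom.toFun (h.hom.toFun x)) (g.hom.toFun (h.hom.toFun x)))
        x).trans hh
    · intro n σ x
      exact Subtype.ext (h.hom.map_op σ x)
    · exact h.hom.nonexpanding
    · rfl

/-- If `m` were universal for `ε = 1`, both embeddings of `P` would factor through it. The submonoid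
image of `m` would then contain `(x, x)`, at distance `2` from the unit when `x ≠ 1`. -/
theorem MonMet.not_hasApproxEqualizers : ¬ HasApproxEqualizers MonMet.{u} := by
  intro H
  let P : MonMet.{u} := truncate (words PUnit)
  let N := prodSum P P
  let i₁ : P ⟶ N := prodInl P P
  let i₂ : P ⟶ N := prodInr P P
  obtain ⟨B, m, hm, hu⟩ := H (𝟙 N) (trivialHom N N) 1
  obtain ⟨k₁, hk₁⟩ := hu i₁ (edist_hom_le_iff.mpr fun x => by
    change edist x 1 + edist (1 : P) 1 ≤ 1
    rw [edist_self, add_zero]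
    exact truncate_edist_le_one _ _)
  obtain ⟨k₂, hk₂⟩ := hu i₂ (edist_hom_le_iff.mpr fun x => by
    change edist (1 : P) 1 + edist x 1 ≤ 1
    rw [edist_self, zero_add]
    exact truncate_edist_le_one _ _)
  obtain ⟨x, hx⟩ := exists_ne (1 : words PUnit.{u + 1})
  let x' : P := x
  have hx1 : edist x' 1 = 1 := by
    change min (⨆ _ : x ≠ 1, ⊤) 1 = (1 : ℝ≥0∞)
    simp [hx]
  have h := edist_hom_le_iff.mp hm (k₁.toHom x' * k₂.toHom x')
  have h₁ : m.toHom (k₁.toHom x') = i₁.toHom x' :=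
    congrArg (fun k : P ⟶ N => k.toHom x') hk₁
  have h₂ : m.toHom (k₂.toHom x') = i₂.toHom x' :=
    congrArg (fun k : P ⟶ N => k.toHom x') hk₂
  change edist (m.toHom (k₁.toHom x' * k₂.toHom x')) 1 ≤ 1 at h
  rw [map_mul, h₁, h₂] at h
  change edist (x' * 1) 1 + edist (1 * x') 1 ≤ 1 at h
  rw [mul_one, one_mul, hx1] at h
  norm_num at h

/-! ## The metric monoid presented by distance bounds -/

/-- Pseudometrics on a monoid for which the multiplication is nonexpanding with respect to the
addition metric. -/
structure IsMonoidPseudoMetric {F : Type*} [Monoid F] (ρ : F → F → ℝ≥0∞) : Prop where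
  self : ∀ x, ρ x x = 0
  comm : ∀ x y, ρ x y = ρ y x
  triangle : ∀ x y z, ρ x z ≤ ρ x y + ρ y z
  mul : ∀ x x' y y', ρ (x * y) (x' * y') ≤ ρ x x' + ρ y y'

/-- The largest monoid pseudometric below the given bounds. -/
def largestPseudoMetric {F : Type*} [Monoid F] (c : F → F → ℝ≥0∞) (x y : F) : ℝ≥0∞ :=
  ⨆ (ρ : F → F → ℝ≥0∞) (_ : IsMonoidPseudoMetric ρ ∧ ∀ a b, ρ a b ≤ c a b), ρ x y

section largest

variable {F : Type*} [Monoid F] (c : F → F → ℝ≥0∞)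

theorem le_largestPseudoMetric {ρ : F → F → ℝ≥0∞} (h : IsMonoidPseudoMetric ρ)
    (hc : ∀ a b, ρ a b ≤ c a b) (x y : F) : ρ x y ≤ largestPseudoMetric c x y :=
  le_iSup₂ (f := fun (ρ : F → F → ℝ≥0∞)
    (_ : IsMonoidPseudoMetric ρ ∧ ∀ a b, ρ a b ≤ c a b) => ρ x y) ρ ⟨h, hc⟩

theorem largestPseudoMetric_le (x y : F) : largestPseudoMetric c x y ≤ c x y :=
  iSup₂_le fun _ h => h.2 x y

theorem isMonoidPseudoMetric_largest : IsMonoidPseudoMetric (largestPseudoMetric c) where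
  self x := le_antisymm (iSup₂_le fun _ h => (h.1.self x).le) bot_le
  comm x y := iSup_congr fun _ => iSup_congr fun h => h.1.comm x y
  triangle x y z := iSup₂_le fun _ h => (h.1.triangle x y z).trans
    (add_le_add (le_largestPseudoMetric c h.1 h.2 _ _) (le_largestPseudoMetric c h.1 h.2 _ _))
  mul x x' y y' := iSup₂_le fun _ h => (h.1.mul x x' y y').trans
    (add_le_add (le_largestPseudoMetric c h.1 h.2 _ _) (le_largestPseudoMetric c h.1 h.2 _ _))

end largest

/-- A monoid equipped with the largest monoid pseudometric below the given bounds. -/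
def Bounded {F : Type u} (_ : F → F → ℝ≥0∞) : Type u := F

namespace Bounded

variable {F : Type u} [Monoid F] (c : F → F → ℝ≥0∞)

instance : Monoid (Bounded c) := inferInstanceAs (Monoid F)

instance : PseudoEMetricSpace (Bounded c) where
  edist := largestPseudoMetric c
  edist_self := (isMonoidPseudoMetric_largest c).self
  edist_comm := (isMonoidPseudoMetric_largest c).comm
  edist_triangle := (isMonoidPseudoMetric_largest c).triangle

theorem edist_mul_le (x x' y y' : Bounded c) :
    edist (x * y) (x' * y') ≤ edist x x' + edist y y' :=
  (isMonoidPseudoMetric_largest c).mul x x' y y'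

-- Continuity lets the multiplication descend to the separation quotient. The factor `2` compares
-- the sum of two distances with their maximum, the metric of the product type.
instance : ContinuousMul (Bounded c) where
  continuous_mul := by
    have : LipschitzWith 2 fun p : Bounded c × Bounded c => p.1 * p.2 := fun p q => by
      refine (edist_mul_le c _ _ _ _).trans ?_
      rw [ENNReal.coe_ofNat, two_mul]
      exact add_le_add (le_max_left _ _) (le_max_right _ _)
    exact this.continuous

end Bounded

namespace MonMet

/-- The metric monoid obtained from a monoid by imposing bounds on distances. -/
def presented {F : Type u} [Monoid F] (c : F → F → ℝ≥0∞) : MonMet.{u} where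
  carrier := SeparationQuotient (Bounded c)
  edist_mul_le x x' y y' := by
    obtain ⟨x, rfl⟩ := SeparationQuotient.surjective_mk x
    obtain ⟨x', rfl⟩ := SeparationQuotient.surjective_mk x'
    obtain ⟨y, rfl⟩ := SeparationQuotient.surjective_mk y
    obtain ⟨y', rfl⟩ := SeparationQuotient.surjective_mk y'
    rw [← SeparationQuotient.mk_mul, ← SeparationQuotient.mk_mul]
    simp only [SeparationQuotient.edist_mk]
    exact Bounded.edist_mul_le c x x' y y'

section presented

variable {F : Type u} [Monoid F] {c : F → F → ℝ≥0∞}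

variable (c) in
/-- The projection to the presented metric monoid. -/
def toPresented : F →* presented c where
  toFun x := SeparationQuotient.mk (X := Bounded c) x
  map_one' := rfl
  map_mul' _ _ := rfl

theorem toPresented_surjective : Function.Surjective (toPresented c) :=
  SeparationQuotient.surjective_mk (X := Bounded c)

theorem edist_toPresented_le (x y : F) : edist (toPresented c x) (toPresented c y) ≤ c x y :=
  (SeparationQuotient.edist_mk (X := Bounded c) x y).trans_le (largestPseudoMetric_le c x y)

/-- The metric of `N` pulled back along `f` is itself a monoid pseudometric below `c`, hence lies
below the largest one. -/
theorem edist_le_edist_toPresented {N : MonMet.{u}} (f : F →* N)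
    (hf : ∀ x y, edist (f x) (f y) ≤ c x y) (x y : F) :
    edist (f x) (f y) ≤ edist (toPresented c x) (toPresented c y) := by
  refine le_of_le_of_eq ?_ (SeparationQuotient.edist_mk (X := Bounded c) x y).symm
  refine le_largestPseudoMetric c (ρ := fun x y => edist (f x) (f y)) ⟨fun x => edist_self _,
    fun x y => edist_comm _ _, fun x y z => edist_triangle _ _ _, fun x x' y y' => ?_⟩ hf x y
  simp only [map_mul]
  exact N.edist_mul_le _ _ _ _

/-- The homomorphism out of a presented metric monoid induced by a homomorphism satisfying the
bounds. -/
def descPresented {N : MonMet.{u}} (f : F →* N) (hf : ∀ x y, edist (f x) (f y) ≤ c x y) :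
    presented c ⟶ N :=
  Hom.mk
    { toFun := fun x => f (Function.surjInv toPresented_surjective x)
      map_one' := by
        refine eq_of_edist_eq_zero (le_antisymm ?_ bot_le)
        rw [← map_one f]
        refine (edist_le_edist_toPresented f hf _ _).trans ?_
        rw [Function.surjInv_eq toPresented_surjective, map_one, edist_self]
      map_mul' := fun x y => by
        refine eq_of_edist_eq_zero (le_antisymm ?_ bot_le)
        rw [← map_mul f]
        refine (edist_le_edist_toPresented f hf _ _).trans ?_
        rw [map_mul, Function.surjInv_eq toPresented_surjective, Function.surjInv_eq toPresented_surjective, Function.surjInv_eq toPresented_surjective, edist_self] }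
    fun x y => (edist_le_edist_toPresented f hf _ _).trans (by
      rw [Function.surjInv_eq toPresented_surjective, Function.surjInv_eq toPresented_surjective])

theorem descPresented_toPresented {N : MonMet.{u}} (f : F →* N)
    (hf : ∀ x y, edist (f x) (f y) ≤ c x y) (x : F) :
    (descPresented f hf).toHom (toPresented c x) = f x := by
  refine eq_of_edist_eq_zero (le_antisymm ?_ bot_le)
  refine (edist_le_edist_toPresented f hf _ _).trans ?_
  rw [Function.surjInv_eq toPresented_surjective, edist_self]

theorem presented_hom_ext {N : MonMet.{u}} {f g : presented c ⟶ N}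
    (h : ∀ x, f.toHom (toPresented c x) = g.toHom (toPresented c x)) : f = g :=
  Hom.ext_fun (funext fun x => by
    obtain ⟨x, rfl⟩ := toPresented_surjective x
    exact h x)

end presented

/-! ## The left adjoint of the hom-functor of a free monoid -/

/-- The bounds presenting the tensor of `M` and `words A`: the copies at `m` and `m'` of any word
have distance at most `d(m, m')`. -/
def tensorBound (A : Type u) (M : Met.{u}) (x y : FreeMonoid (M × A)) : ℝ≥0∞ :=
  ⨅ (m : M) (m' : M) (w : FreeMonoid A)
    (_ : x = FreeMonoid.map (fun a => (m, a)) w ∧ y = FreeMonoid.map (fun a => (m', a)) w),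
    edist m m'

/-- The value of the left adjoint of the hom-functor of `words A`. -/
def tensorWords (A : Type u) (M : Met.{u}) : MonMet.{u} :=
  presented (tensorBound A M)

/-- The member at `m` of a family of homomorphisms indexed by `M`. -/
def familyAt {A : Type u} {M : Met.{u}} {N : MonMet.{u}}
    (g : M ⟶ (homFunctor (words A)).obj N) (m : M) : FreeMonoid A →* N :=
  Hom.toHom (M := words A) (N := N) (g.toFun m)

/-- The homomorphism on words over `M × A` given by a family of homomorphisms. -/
def familyLift {A : Type u} {M : Met.{u}} {N : MonMet.{u}}
    (g : M ⟶ (homFunctor (words A)).obj N) : FreeMonoid (M × A) →* N :=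
  FreeMonoid.lift fun p => familyAt g p.1 (FreeMonoid.of p.2)

theorem familyLift_map {A : Type u} {M : Met.{u}} {N : MonMet.{u}}
    (g : M ⟶ (homFunctor (words A)).obj N) (m : M) (w : FreeMonoid A) :
    familyLift g (FreeMonoid.map (fun a => (m, a)) w) = familyAt g m w := by
  rw [← MonoidHom.comp_apply]
  congr 1
  exact FreeMonoid.hom_eq fun a => by simp [familyLift]

/-- The bounds compare copies of whole words, not only of letters, since the supremum metric on
homomorphisms requires `d(m, m')` uniformly over all words. -/
theorem edist_familyLift_le {A : Type u} {M : Met.{u}} {N : MonMet.{u}}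
    (g : M ⟶ (homFunctor (words A)).obj N) (x y : FreeMonoid (M × A)) :
    edist (familyLift g x) (familyLift g y) ≤ tensorBound A M x y := by
  refine le_iInf fun m => le_iInf fun m' => le_iInf fun w => le_iInf ?_
  rintro ⟨rfl, rfl⟩
  rw [familyLift_map, familyLift_map]
  exact (edist_apply_le (M := words A) (N := N) (g.toFun m) (g.toFun m') w).trans
    (g.nonexpanding m m')

/-- The family of homomorphisms given by a homomorphism out of the tensor. -/
def tensorCurry {A : Type u} {M : Met.{u}} {N : MonMet.{u}} (f : tensorWords A M ⟶ N) :
    M ⟶ (homFunctor (words A)).obj N :=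
  Met.Hom.mk
    (fun m => (Hom.mk (f.toHom.comp ((toPresented _).comp (FreeMonoid.map fun a => (m, a))))
      (hom_to_words_nonexpanding _) : words A ⟶ N))
    fun m m' => edist_hom_le_iff.mpr fun w =>
      (f.nonexpanding _ _).trans ((edist_toPresented_le _ _).trans
        (iInf_le_of_le m (iInf_le_of_le m' (iInf_le_of_le w (iInf_le _ ⟨rfl, rfl⟩)))))

theorem familyLift_tensorCurry {A : Type u} {M : Met.{u}} {N : MonMet.{u}}
    (f : tensorWords A M ⟶ N) : familyLift (tensorCurry f) = f.toHom.comp (toPresented _) :=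
  FreeMonoid.hom_eq fun p => (FreeMonoid.lift_eval_of _ p).trans rfl

/-- Homomorphisms out of the tensor correspond to nonexpanding maps to the hom-set. -/
def tensorWordsEquiv (A : Type u) (M : Met.{u}) (N : MonMet.{u}) :
    (tensorWords A M ⟶ N) ≃ (M ⟶ (homFunctor (words A)).obj N) where
  toFun := tensorCurry
  invFun g := descPresented (familyLift g) (edist_familyLift_le g)
  left_inv f := presented_hom_ext fun x => by
    rw [descPresented_toPresented, familyLift_tensorCurry]
    rfl
  right_inv g := Met.Hom.ext <| funext fun m =>
    Hom.ext_fun (M := words A) (N := N) <| funext fun w =>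
      (descPresented_toPresented _ (edist_familyLift_le g) _).trans (familyLift_map g m w)

theorem isRightAdjoint_homFunctor_words (A : Type u) :
    (homFunctor (words A)).IsRightAdjoint :=
  (Adjunction.adjunctionOfEquivLeft (tensorWordsEquiv A) fun _ _ _ _ _ => rfl).isRightAdjoint

end MonMet

/-! ## Retracts of free monoids -/

section Retract

variable {M B : Type*} [Monoid M] (i : M →* FreeMonoid B) (r : FreeMonoid B →* M)

/-- The elements different from `1` that are not products of two such elements. -/
def monoidAtoms (M : Type*) [Monoid M] : Set M :=
  {a | a ≠ 1 ∧ ∀ x y, a = x * y → x = 1 ∨ y = 1}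

/-- Word length under `i` is additive and positive off `1`, so splitting a non-atom strictly
decreases it and factorization into atoms terminates. -/
theorem lift_atoms_surjective (hi : Function.Injective i) :
    Function.Surjective (FreeMonoid.lift ((↑) : monoidAtoms M → M)) := by
  have hlen {x : M} (hx : x ≠ 1) : 0 < (i x).length := by
    rw [Nat.pos_iff_ne_zero, Ne, FreeMonoid.length_eq_zero]
    exact fun h => hx (hi (h.trans (map_one i).symm))
  suffices ∀ (n : ℕ) (x : M), (i x).length ≤ n →
      x ∈ MonoidHom.mrange (FreeMonoid.lift ((↑) : monoidAtoms M → M)) from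
    fun x => this _ x le_rfl
  intro n
  induction n with
  | zero =>
    intro x hx
    by_cases h : x = 1
    · exact h ▸ one_mem _
    · exact absurd (hlen h) (by omega)
  | succ n ih =>
    intro x hx
    by_cases h : x = 1
    · exact h ▸ one_mem _
    by_cases ha : x ∈ monoidAtoms M
    · exact ⟨FreeMonoid.of ⟨x, ha⟩, by simp⟩
    · have : ∃ y z, x = y * z ∧ y ≠ 1 ∧ z ≠ 1 := by
        by_contra! hcon
        exact ha ⟨h, fun y z hyz => or_iff_not_imp_left.mpr (hcon y z hyz)⟩
      obtain ⟨y, z, rfl, hy, hz⟩ := this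
      rw [map_mul, FreeMonoid.length_mul] at hx
      have := hlen hy
      have := hlen hz
      exact mul_mem (ih y (by omega)) (ih z (by omega))

/-- If two products of atoms agree, the image under `i` of one leading atom is a prefix of that of
the other. The retraction `r` carries the remaining factor back into `M`, so indecomposability makes
the leading atoms equal, and cancellation inherited from the free monoid finishes by induction. -/
theorem lift_atoms_injective (hr : ∀ x, r (i x) = x) :
    Function.Injective (FreeMonoid.lift ((↑) : monoidAtoms M → M)) := by
  have hi : Function.Injective i := Function.LeftInverse.injective hr
  have hcancel {x y z : M} (h : x * y = x * z) : y = z := by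
    apply hi
    have := congrArg i h
    rw [map_mul, map_mul] at this
    exact mul_left_cancel this
  have hatom {a b : M} (ha : a ∈ monoidAtoms M) (hb : b ∈ monoidAtoms M) {v : FreeMonoid B}
      (h : i b = i a * v) : a = b := by
    have hb' : b = a * r v := by
      rw [← hr b, h, map_mul, hr]
    rcases hb.2 _ _ hb' with h1 | h1
    · exact absurd h1 ha.1
    · rw [hb', h1, mul_one]
  have hne (a : monoidAtoms M) (w : FreeMonoid (monoidAtoms M)) :
      (a : M) * FreeMonoid.lift ((↑) : monoidAtoms M → M) w ≠ 1 := fun h => by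
    have := congrArg i h
    rw [map_mul, map_one, ← FreeMonoid.length_eq_zero, FreeMonoid.length_mul] at this
    have h0 : (i a).length = 0 := by omega
    rw [FreeMonoid.length_eq_zero, ← map_one i] at h0
    exact a.2.1 (hi h0)
  intro w
  induction w using FreeMonoid.inductionOn' with
  | one =>
    intro w' h
    cases w' using FreeMonoid.casesOn with
    | one => rfl
    | of_mul a w' =>
      rw [map_one, map_mul, FreeMonoid.lift_eval_of] at h
      exact absurd h.symm (hne a w')
  | of_mul a w ih =>
    intro w' h
    cases w' using FreeMonoid.casesOn with
    | one =>
      rw [map_one, map_mul, FreeMonoid.lift_eval_of] at h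
      exact absurd h (hne a w)
    | of_mul b w' =>
      rw [map_mul, map_mul, FreeMonoid.lift_eval_of, FreeMonoid.lift_eval_of] at h
      have hab : a = b := by
        have h' := congrArg i h
        rw [map_mul, map_mul] at h'
        rcases List.append_eq_append_iff.mp (congrArg FreeMonoid.toList h') with
          ⟨v, hv, -⟩ | ⟨v, hv, -⟩
        · exact Subtype.ext (hatom a.2 b.2 (v := FreeMonoid.ofList v) hv)
        · exact Subtype.ext (hatom b.2 a.2 (v := FreeMonoid.ofList v) hv).symm
      subst hab
      rw [ih (hcancel h)]

end Retract

namespace MonMet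

/-! ## Subregular epimorphisms onto metric monoids -/

/-- A monoid with the discrete metric. -/
def discrete (M : Type u) [Monoid M] : MonMet.{u} where
  carrier := M
  metric := discreteMetric _
  edist_mul_le x x' y y' := by
    by_cases hx : x = x'
    · by_cases hy : y = y'
      · subst hx hy; simp
      · simp [hy, edist]
    · simp [hx, edist]

theorem edist_discrete_of_ne {M : Type u} [Monoid M] {x y : discrete M} (h : x ≠ y) :
    edist x y = ⊤ := by
  change ⨆ _ : x ≠ y, ⊤ = (⊤ : ℝ≥0∞)
  simp [h]

/-- A homomorphism from a discrete monoid is nonexpanding. -/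
def ofDiscrete {M : Type u} [Monoid M] {N : MonMet.{u}} (f : M →* N) : discrete M ⟶ N :=
  Hom.mk f fun x y => by
    by_cases h : x = y
    · subst h; simp
    · exact le_top.trans_eq (edist_discrete_of_ne h).symm

theorem eq_of_edist_discrete_ne_top {M : Type u} [Monoid M] {x y : discrete M}
    (h : edist x y ≠ ⊤) : x = y :=
  by_contra fun hne => h (edist_discrete_of_ne hne)

/-- The basic diagram of an increasing family of submonoids of `X × X`. -/
def basicDiagram (X : MonMet.{u}) (S : ℝ≥0 → Submonoid (X × X)) (hS : Monotone S) :
    BasicDiagram X where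
  D :=
    { obj := fun ε => discrete (S ε)
      map := fun h => ofDiscrete (Submonoid.inclusion (hS h.le))
      map_id := fun _ => rfl
      map_comp := fun _ _ => rfl }
  l := { app := fun ε => ofDiscrete ((MonoidHom.fst X X).comp (S ε).subtype)
         naturality := fun _ _ _ => rfl }
  r := { app := fun ε => ofDiscrete ((MonoidHom.snd X X).comp (S ε).subtype)
         naturality := fun _ _ _ => rfl }

theorem compatible_basicDiagram_iff {X Y : MonMet.{u}} {S : ℝ≥0 → Submonoid (X × X)}
    {hS : Monotone S} {f : X ⟶ Y} : (basicDiagram X S hS).Compatible f ↔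
      ∀ ε, ∀ p ∈ S ε, edist (f.toHom p.1) (f.toHom p.2) ≤ (ε : ℝ≥0∞) :=
  forall_congr' fun _ => edist_hom_le_iff.trans
    ⟨fun h p hp => h ⟨p, hp⟩, fun h p => h p.1 p.2⟩

/-- Hypothesis `hu` says the metric of `Y` dominates every one compatible with the relations, so a
compatible `g` descends along any set-theoretic section of `f`. Surjectivity alone yields the
quotient property. -/
theorem isSubregularEpi_of_surjective {X Y : MonMet.{u}} (f : X ⟶ Y)
    (hf : Function.Surjective f.toHom) (S : ℝ≥0 → Submonoid (X × X)) (hS : Monotone S)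
    (hc : ∀ ε, ∀ p ∈ S ε, edist (f.toHom p.1) (f.toHom p.2) ≤ (ε : ℝ≥0∞))
    (hu : ∀ ⦃Z : MonMet.{u}⦄ (g : X ⟶ Z),
      (∀ ε, ∀ p ∈ S ε, edist (g.toHom p.1) (g.toHom p.2) ≤ (ε : ℝ≥0∞)) →
      ∀ x y, edist (g.toHom x) (g.toHom y) ≤ edist (f.toHom x) (f.toHom y)) :
    IsSubregularEpi f := by
  refine ⟨basicDiagram X S hS, compatible_basicDiagram_iff.mpr hc, fun U u₁ u₂ => ?_,
    fun Z g hg => ?_⟩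
  · exact (hf.iSup_comp fun y => edist (u₁.toHom y) (u₂.toHom y)).symm
  · have hle := hu g (compatible_basicDiagram_iff.mp hg)
    have heq {x y : X} (h : f.toHom x = f.toHom y) : g.toHom x = g.toHom y :=
      eq_of_edist_eq_zero (le_antisymm ((hle x y).trans (by rw [h, edist_self])) bot_le)
    refine ⟨Hom.mk
      { toFun := fun y => g.toHom (Function.surjInv hf y)
        map_one' := (heq (by rw [Function.surjInv_eq hf, map_one])).trans (map_one g.toHom)
        map_mul' := fun x y => (heq (by
          rw [map_mul, Function.surjInv_eq hf, Function.surjInv_eq hf,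
            Function.surjInv_eq hf])).trans (map_mul g.toHom _ _) }
      fun x y => (hle _ _).trans (by rw [Function.surjInv_eq hf, Function.surjInv_eq hf]), ?_⟩
    exact Hom.ext_fun (funext fun x => heq (Function.surjInv_eq hf _))

/-! ## Every metric monoid embeds in a subregular quotient of a discrete one -/

section Embedding

variable (G : MonMet.{u})

/-- Elements of a metric monoid with a stack of such elements, with the addition metric. -/
def stack : Met.{u} where
  carrier := G × (ℕ → G)
  metric :=
    { edist := fun x y => edist x.1 y.1 + ∑' n, edist (x.2 n) (y.2 n)
      edist_self := fun x => by simp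
      edist_comm := fun x y => by simp only [edist_comm]
      edist_triangle := fun x y z => by
        refine (add_le_add (edist_triangle x.1 y.1 z.1) ((ENNReal.tsum_le_tsum fun n =>
          edist_triangle (x.2 n) (y.2 n) (z.2 n)).trans_eq ENNReal.tsum_add)).trans_eq ?_
        exact add_add_add_comm _ _ _ _
      eq_of_edist_eq_zero := fun {x y} h => by
        obtain ⟨h₁, h₂⟩ := add_eq_zero.mp h
        refine Prod.ext (eq_of_edist_eq_zero h₁) (funext fun n => ?_)
        exact eq_of_edist_eq_zero (ENNReal.tsum_eq_zero.mp h₂ n) }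

variable {G}

theorem edist_stack (x y : stack G) :
    edist x y = edist x.1 y.1 + (edist (x.2 0) (y.2 0) + ∑' n, edist (x.2 (n + 1)) (y.2 (n + 1))) := by
  rw [← tsum_eq_zero_add' (f := fun n => edist (x.2 n) (y.2 n)) ENNReal.summable]
  rfl

/-- Replaces the top of a stack. -/
def withTop (g : G) (s : ℕ → G) : ℕ → G
  | 0 => g
  | n + 1 => s (n + 1)

/-- Adds a new top to a stack. -/
def pushTop (g : G) (s : ℕ → G) : ℕ → G
  | 0 => g
  | n + 1 => s n

/-- Multiplication by the top of the stack, which is removed. -/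
def stackPop : End (stack G) :=
  Met.Hom.mk (fun x => (x.2 0 * x.1, fun n => x.2 (n + 1))) fun x y => by
    rw [edist_stack x y]
    change edist (x.2 0 * x.1) (y.2 0 * y.1) + _ ≤ _
    rw [← add_assoc, add_comm (edist x.1 y.1)]
    exact add_le_add_left (G.edist_mul_le _ _ _ _) _

/-- Pushing `1` on the stack. -/
def stackPush : End (stack G) :=
  Met.Hom.mk (fun x => (x.1, pushTop 1 x.2)) fun x y => by
    refine (edist_stack _ _).trans_le ?_
    change edist x.1 y.1 + (edist (1 : G) 1 + ∑' n, edist (x.2 n) (y.2 n)) ≤ _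
    rw [edist_self, zero_add]
    rfl

/-- Replacing the top of the stack by `g`. -/
def stackSet (g : G) : End (stack G) :=
  Met.Hom.mk (fun x => (x.1, withTop g x.2)) fun x y => by
    refine (edist_stack _ _).trans_le ?_
    rw [edist_stack x y]
    change edist x.1 y.1 + (edist g g + ∑' n, edist (x.2 (n + 1)) (y.2 (n + 1))) ≤ _
    rw [edist_self]
    gcongr
    exact bot_le

/-- Endomorphisms of a metric space with the supremum metric. -/
def endo (Z : Met.{u}) : MonMet.{u} where
  carrier := End Z
  metric := MetricEnriched.homMetric Z Z
  monoid := inferInstance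
  edist_mul_le x x' y y' :=
    (MetricEnriched.edist_comp_le y y' x x').trans_eq (add_comm _ _)

/-- This left-zero law is the reason for the stack. It makes the pairs of replacements, with the
unit, closed under products, so they form a submonoid of pairs with the same bound `ε`. For
arbitrary pairs the errors would add up under multiplication. -/
theorem stackSet_mul (g h : G) :
    stackSet g * stackSet h = stackSet g :=
  Met.Hom.ext (funext fun x => Prod.ext (α := G) (β := ℕ → G) rfl
    (funext fun n => by cases n <;> rfl))

theorem edist_stackSet_le (g h : G) : edist (α := stack G ⟶ stack G) (stackSet g) (stackSet h) ≤ edist g h :=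
  iSup_le fun x => by
    refine (edist_stack _ _).trans_le ?_
    change edist x.1 x.1 + (edist g h + ∑' n, edist (x.2 (n + 1)) (x.2 (n + 1))) ≤ _
    simp

/-- Left multiplication by `g`, expressed by the operations on stacks. -/
def stackAct : G →* End (stack G) where
  toFun g := stackPop * stackSet g * stackPush
  map_one' := Met.Hom.ext (funext fun _ => Prod.ext (one_mul _) rfl)
  map_mul' _ _ := Met.Hom.ext (funext fun _ => Prod.ext (mul_assoc _ _ _) (funext fun _ => rfl))

theorem stackAct_injective : Function.Injective (stackAct (G := G)) := fun g h hgh => by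
  have := congrArg (fun k : stack G ⟶ stack G => (k.toFun (1, fun _ => 1)).1) hgh
  change g * 1 = h * 1 at this
  rwa [mul_one, mul_one] at this

variable (G)

/-- The pairs of replacements by elements of distance at most `ε`, with the pair of units. -/
def stackRel (ε : ℝ≥0) : Submonoid (End (stack G) × End (stack G)) where
  carrier := {p | p = 1 ∨ ∃ g h : G, edist g h ≤ ε ∧ p = (stackSet g, stackSet h)}
  one_mem' := Or.inl rfl
  mul_mem' := by
    rintro _ _ (rfl | ⟨g, h, hgh, rfl⟩) (rfl | ⟨g', h', hgh', rfl⟩)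
    · exact Or.inl (one_mul _)
    · exact Or.inr ⟨g', h', hgh', one_mul _⟩
    · exact Or.inr ⟨g, h, hgh, mul_one _⟩
    · exact Or.inr ⟨g, h, hgh, Prod.ext (stackSet_mul _ _) (stackSet_mul _ _)⟩

theorem stackRel_mono : Monotone (stackRel G) := by
  rintro ε ε' h p (hp | ⟨g, k, hgk, hp⟩)
  · exact Or.inl hp
  · exact Or.inr ⟨g, k, hgk.trans (by exact_mod_cast h), hp⟩

/-- The bounds given by the relations `stackRel G ε`. -/
def stackBound (p q : End (stack G)) : ℝ≥0∞ :=
  ⨅ (ε : ℝ≥0) (_ : (p, q) ∈ stackRel G ε), (ε : ℝ≥0∞)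

variable {G}

theorem stackBound_stackSet_le (g h : G) : stackBound G (stackSet g) (stackSet h) ≤ edist g h := by
  by_cases htop : edist g h = ⊤
  · exact htop ▸ le_top
  · lift edist g h to ℝ≥0 using htop with ε hε
    exact iInf₂_le_of_le ε (Or.inr ⟨g, h, hε.ge, rfl⟩) le_rfl

theorem isSubregularEpi_toPresented_stack :
    IsSubregularEpi (ofDiscrete (toPresented (stackBound G))) :=
  isSubregularEpi_of_surjective _ toPresented_surjective (stackRel G) (stackRel_mono G)
    (fun ε _ hp => (edist_toPresented_le _ _).trans (iInf₂_le ε hp))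
    fun _ g hg => edist_le_edist_toPresented g.toHom fun _ _ =>
      le_iInf₂ fun ε hp => hg ε _ hp

theorem edist_mul_mul_le {N : MonMet.{u}} (a b x y : N) :
    edist (a * x * b) (a * y * b) ≤ edist x y := by
  refine (N.edist_mul_le _ _ _ _).trans ?_
  rw [edist_self, add_zero]
  refine (N.edist_mul_le _ _ _ _).trans ?_
  rw [edist_self, zero_add]

theorem toPresented_stackAct (g : G) : toPresented (stackBound G) (stackAct g) =
    toPresented (stackBound G) stackPop * toPresented (stackBound G) (stackSet g) *
      toPresented (stackBound G) stackPush := by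
  rw [← map_mul, ← map_mul]
  rfl

variable (G) in
/-- The homomorphism `stackAct` to the presented metric monoid. -/
def stackEmbedding : G ⟶ presented (stackBound G) :=
  Hom.mk ((toPresented (stackBound G)).comp stackAct) fun g h => by
    -- Only the middle factor depends on the element, and multiplying by fixed factors on both sides
    -- does not increase distance.
    rw [MonoidHom.comp_apply, MonoidHom.comp_apply, toPresented_stackAct, toPresented_stackAct]
    exact (edist_mul_mul_le _ _ _ _).trans
      ((edist_toPresented_le _ _).trans (stackBound_stackSet_le g h))

/-- The supremum metric on endomorphisms of the stack already satisfies the imposed bounds, so the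
presented metric dominates it and identifies no two distinct endomorphisms. -/
theorem stackEmbedding_injective : Function.Injective (stackEmbedding G).toHom := by
  intro g h hgh
  apply stackAct_injective
  have hb (p q : End (stack G)) : edist (MonoidHom.id (endo (stack G)) p)
      (MonoidHom.id (endo (stack G)) q) ≤ stackBound G p q := by
    refine le_iInf₂ fun ε hp => ?_
    rcases hp with hp | ⟨g, h, hgh, hp⟩
    · obtain ⟨rfl, rfl⟩ := Prod.mk.inj hp
      rw [edist_self]
      exact bot_le
    · obtain ⟨rfl, rfl⟩ := Prod.mk.inj hp
      exact (edist_stackSet_le g h).trans hgh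
  refine eq_of_edist_eq_zero (α := endo (stack G)) (le_antisymm ?_ bot_le)
  refine (edist_le_edist_toPresented (N := endo (stack G)) (MonoidHom.id _) hb _ _).trans ?_
  exact (edist_eq_zero.mpr hgh).le

end Embedding

/-! ## Subregular projectives -/

/-- The embedding of `G` lifts to a discrete monoid. A nonexpanding map there identifies points at
finite distance, while the lift is injective because the embedding is. -/
theorem edist_eq_top_of_isSubregularProjective {G : MonMet.{u}}
    (hG : IsSubregularProjective G) {x y : G} (h : x ≠ y) : edist x y = ⊤ := by
  obtain ⟨k, hk⟩ := hG _ isSubregularEpi_toPresented_stack (stackEmbedding G)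
  by_contra hne
  have hxy : k.toHom x = k.toHom y :=
    eq_of_edist_discrete_ne_top (ne_top_of_le_ne_top hne (k.nonexpanding x y))
  apply h
  apply stackEmbedding_injective
  rw [← hk]
  exact congrArg (toPresented (stackBound G)) hxy

theorem exists_iso_words_of_isSubregularProjective {G : MonMet.{u}}
    (hG : IsSubregularProjective G) : ∃ A : Type u, Nonempty (G ≅ words A) := by
  let p : FreeMonoid G →* G := FreeMonoid.lift id
  have hp : Function.Surjective p := fun x => ⟨FreeMonoid.of x, by simp [p]⟩
  have hepi : IsSubregularEpi (ofDiscrete p) := by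
    refine isSubregularEpi_of_surjective (ofDiscrete p) hp
      -- The relation is the kernel pair of `p` for every `ε`. Imposing equalities suffices because
      -- `G` is already known to be discrete.
      (fun _ => MonoidHom.eqLocusM (p.comp (MonoidHom.fst _ _)) (p.comp (MonoidHom.snd _ _)))
      monotone_const (fun ε q hq => ?_) fun Z g hg x y => ?_
    · exact (edist_eq_zero.mpr hq).trans_le bot_le
    · by_cases h : p x = p y
      · exact (hg 0 (x, y) h).trans bot_le
      · exact le_top.trans_eq (edist_eq_top_of_isSubregularProjective hG h).symm
  obtain ⟨i, hi⟩ := hG _ hepi (𝟙 G)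
  have hr (x : G) : p (i.toHom x) = x := congrArg (fun k : G ⟶ G => k.toHom x) hi
  let e : FreeMonoid (monoidAtoms G) ≃* G := MulEquiv.ofBijective _
    ⟨lift_atoms_injective i.toHom p hr,
      lift_atoms_surjective i.toHom (Function.LeftInverse.injective hr)⟩
  refine ⟨monoidAtoms G, ⟨⟨Hom.mk e.symm.toMonoidHom fun x y => ?_,
    Hom.mk e.toMonoidHom (hom_to_words_nonexpanding _), ?_, ?_⟩⟩⟩
  · by_cases h : x = y
    · subst h; simp
    · exact le_top.trans_eq (edist_eq_top_of_isSubregularProjective hG h).symm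
  · exact Hom.ext_fun (funext e.apply_symm_apply)
  · exact Hom.ext_fun (funext e.symm_apply_apply)

end MonMet

end

end QuantAlg

theorem mainTheorem11 :
    (∀ (S : QuantAlg.Signature.{u}) (E : Set (QuantAlg.QuantEquation S)),
      ¬ QuantAlg.EnrichedEquivalent QuantAlg.MonMet.{u} (QuantAlg.Variety S E)) ∧
    (∀ G : QuantAlg.MonMet.{u}, ¬ QuantAlg.IsSubvarietalGenerator G) ∧
    (∀ G : QuantAlg.MonMet.{u}, QuantAlg.IsSubregularProjective G →
      ∃ A : Type u, Nonempty (G ≅ QuantAlg.MonMet.words A)) ∧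
    (∀ A : Type u, Nonempty A →
      (QuantAlg.homFunctor (QuantAlg.MonMet.words A)).IsRightAdjoint ∧
      ∀ L : QuantAlg.Met.{u} ⥤ QuantAlg.MonMet.{u},
        Nonempty (L ⊣ QuantAlg.homFunctor (QuantAlg.MonMet.words A)) →
        ¬ QuantAlg.IsEnrichedFunctor L) :=
  ⟨fun S E h => QuantAlg.MonMet.not_hasApproxEqualizers
      (.of_equivalent h (QuantAlg.Variety.hasApproxEqualizers S E)),
    fun G h => QuantAlg.MonMet.not_isSubregularGenerator G h.generator,
    fun _ h => QuantAlg.MonMet.exists_iso_words_of_isSubregularProjective h,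
    fun A _ => ⟨QuantAlg.MonMet.isRightAdjoint_homFunctor_words A,
      fun _ ⟨adj⟩ => QuantAlg.MonMet.not_isEnrichedFunctor_of_nontrivial adj⟩⟩
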